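/- **Theorem (Flash Attention).** The one-shot partial-computing red-blue pebble game (PRBP) with fast memory of size $r$ on a finite DAG $G=(V,E)$ is played as follows. Each node carries either no pebble, a blue pebble only, a blue and a light red pebble, or a dark red pebble only. Initially exactly the source nodes carry a blue pebble, there are no other pebbles, and no edge is marked. The moves are: (save) replace a dark red pebble by a blue and a light red pebble; (load) place a light red pebble on a node that has a blue pebble; (partial compute) for an unmarked edge $(u,v)$ such that all incoming edges of $u$ are marked, $u$ has a red (light or dark) pebble, and $v$ has either a red pebble or no pebble at all, replace all pebbles on $v$ by a dark red pebble and mark $(u,v)$; (delete) remove a light red pebble from a node, or a dark red pebble from a node all of whose outgoing edges are marked. At most $r$ nodes may carry a red pebble at any time. In the end every sink must carry a blue pebble and every edge must be marked. The cost of a strategy is its number of save and load moves, and $\mathrm{OPT}_{PRBP}(G,r)$ is the minimum cost of a strategy ($+\infty$ if there is none). For $m,d\ge 1$, the self-attention DAG of $m\times d$ matrices $Q,K,V$ with standard matrix multiplication, computing $\mathrm{softmax}(QK^T)V$, consists of * source nodes $Q_{i,l}$, $K_{j,l}$ and $V_{j,l}$ ($i,j\in[m]$, $l\in[d]$); * for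 all $i,j,l$ a product node $p_{i,j,l}$ with incoming edges from $Q_{i,l}$ and $K_{j,l}$, and for all $i,j$ a score node $s_{i,j}$ (the entry $(i,j)$ of $QK^T$) with incoming edges from $p_{i,j,1},\dots,p_{i,j,d}$; * for all $i,j$ a node $e_{i,j}$ (the exponential) with an incoming edge from $s_{i,j}$, for all $i$ a row-sum node $\sigma_i$ with incoming edges from $e_{i,1},\dots,e_{i,m}$, and for all $i,j$ a weight node $w_{i,j}$ with incoming edges from $e_{i,j}$ and $\sigma_i$; * for all $i,j,l$ a product node $p'_{i,j,l}$ with incoming edges from $w_{i,j}$ and $V_{j,l}$, and for all $i,l$ an output node $o_{i,l}$ with incoming edges from $p'_{i,1,l},\dots,p'_{i,m,l}$. There is an absolute constant $c>0$ such that for all integers $m,d,r\ge 1$, the self-attention DAG $G$ satisfies $$\mathrm{OPT}_{PRBP}(G,r)\;\ge\; c\cdot\min\left(\frac{m^2 d}{\sqrt r},\ \frac{m^2d^2}{r}\right).$$ The same bound, with the same constant $c$, holds for every DAG obtained from the nodes $Q_{i,l}$, $K_{j,l}$, $p_{i,j,l}$, $s_{i,j}$ and the edges between them by continuing with an arbitrary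 finite DAG $T$ on further nodes, with arbitrary edges from score nodes to nodes of $T$ such that every score node has at least one outgoing edge. -/

import Mathlib

/-- A directed acyclic graph on the node set `V`; `Adj u v` means that there is an edge `(u, v)`. -/
structure Dag (V : Type*) where
  Adj : V → V → Prop
  acyclic : ∀ v, ¬ Relation.TransGen Adj v v

namespace Dag

def IsSource {V : Type*} (G : Dag V) (v : V) : Prop := ∀ u, ¬ G.Adj u v

def IsSink {V : Type*} (G : Dag V) (v : V) : Prop := ∀ w, ¬ G.Adj v w

/-- A relation along which a natural number strictly increases is acyclic. -/
theorem acyclic_of_rank {V : Type*} {R : V → V → Prop} (f : V → ℕ)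
    (h : ∀ u v, R u v → f u < f v) (v : V) : ¬ Relation.TransGen R v v := by
  have key : ∀ u w, Relation.TransGen R u w → f u < f w := by
    intro u w huw
    induction huw with
    | single h1 => exact h _ _ h1
    | tail _ h2 ih => exact ih.trans (h _ _ h2)
  exact fun hv => lt_irrefl _ (key v v hv)

end Dag

/-! ### The partial-computing red-blue pebble game (one-shot) -/

namespace PRBP

/-- The four possible sets of pebbles on a node: no pebble; only a blue pebble; a blue and a
light red pebble; only a dark red pebble. -/
inductive Pebbles where
  | empty
  | blue
  | blueLight
  | dark

/-- The node carries a (light or dark) red pebble. -/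
def Pebbles.HasRed (p : Pebbles) : Prop := p = .blueLight ∨ p = .dark

/-- The node carries a blue pebble. -/
def Pebbles.HasBlue (p : Pebbles) : Prop := p = .blue ∨ p = .blueLight

/-- A configuration of the game: the pebbles on every node, and the set of marked edges. -/
structure Config (V : Type*) where
  pebbles : V → Pebbles
  marked : Set (V × V)

/-- The moves of the game; `compute u v` is the partial compute step on the edge `(u, v)`. -/
inductive Move (V : Type*) where
  | save (v : V)
  | load (v : V)
  | compute (u v : V)
  | delete (v : V)

/-- Saves and loads cost `1`, partial compute steps and deletions are free. -/
def Move.cost {V : Type*} : Move V → ℕ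
  | .save _ => 1
  | .load _ => 1
  | .compute _ _ => 0
  | .delete _ => 0

/-- The condition under which a move may be executed. A light red pebble may always be deleted,
a dark red pebble only if all outgoing edges of the node are marked. -/
def Legal {V : Type*} (G : Dag V) (s : Config V) : Move V → Prop
  | .save v => s.pebbles v = .dark
  | .load v => (s.pebbles v).HasBlue
  | .compute u v =>
      G.Adj u v ∧ (u, v) ∉ s.marked ∧ (∀ w, G.Adj w u → (w, u) ∈ s.marked) ∧
        (s.pebbles u).HasRed ∧ ((s.pebbles v).HasRed ∨ s.pebbles v = .empty)
  | .delete v =>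
      s.pebbles v = .blueLight ∨
        (s.pebbles v = .dark ∧ ∀ w, G.Adj v w → (v, w) ∈ s.marked)

open Classical in
/-- The configuration after a (legal) move. -/
noncomputable def step {V : Type*} (s : Config V) : Move V → Config V
  | .save v => { s with pebbles := Function.update s.pebbles v .blueLight }
  | .load v => { s with pebbles := Function.update s.pebbles v .blueLight }
  | .compute u v =>
      { pebbles := Function.update s.pebbles v .dark, marked := insert (u, v) s.marked }
  | .delete v =>
      { s with pebbles := Function.update s.pebbles v
                (if s.pebbles v = .blueLight then .blue else .empty) }

open Classical in
/-- Initially exactly the sources carry a blue pebble, and no edge is marked. -/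
noncomputable def initial {V : Type*} (G : Dag V) : Config V where
  pebbles := fun v => if G.IsSource v then .blue else .empty
  marked := ∅

/-- In the end every sink carries a blue pebble, and every edge is marked. -/
def Terminal {V : Type*} (G : Dag V) (s : Config V) : Prop :=
  (∀ v, G.IsSink v → (s.pebbles v).HasBlue) ∧ ∀ u v, G.Adj u v → (u, v) ∈ s.marked

/-- The number of red pebbles is at most `r`. -/
def FitsIn {V : Type*} (s : Config V) (r : ℕ) : Prop :=
  {v | (s.pebbles v).HasRed}.encard ≤ (r : ℕ∞)

/-- The list of moves is legal from the configuration `s` on, never uses more than `r` red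
pebbles, and ends in a terminal configuration. -/
def Completes {V : Type*} (G : Dag V) (r : ℕ) : Config V → List (Move V) → Prop
  | s, [] => FitsIn s r ∧ Terminal G s
  | s, a :: l => FitsIn s r ∧ Legal G s a ∧ Completes G r (step s a) l

/-- A pebbling strategy with fast memory of size `r`. -/
def IsStrategy {V : Type*} (G : Dag V) (r : ℕ) (l : List (Move V)) : Prop :=
  Completes G r (initial G) l

/-- The cost of a strategy: its total number of save and load operations. -/
def cost {V : Type*} (l : List (Move V)) : ℕ := (l.map Move.cost).sum

/-- The optimal cost of a strategy (`⊤` if there is no strategy at all). -/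
noncomputable def opt {V : Type*} (G : Dag V) (r : ℕ) : ℕ∞ :=
  ⨅ (l : List (Move V)) (_ : IsStrategy G r l), (cost l : ℕ∞)

end PRBP

/-! ### Attention DAGs -/

namespace Attention

/-- The nodes of the standard multiplication `Q * Kᵀ` of an `m × d` by a `d × m` matrix: the entries
of `Q` and of `K`, the products `Q i l * K j l`, and the entries of `Q * Kᵀ`. -/
inductive ScoreNode (m d : ℕ) where
  | query (i : Fin m) (l : Fin d)
  | key (j : Fin m) (l : Fin d)
  | prod (i j : Fin m) (l : Fin d)
  | score (i j : Fin m)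

inductive ScoreEdge (m d : ℕ) : ScoreNode m d → ScoreNode m d → Prop where
  | query_prod (i j : Fin m) (l : Fin d) : ScoreEdge m d (.query i l) (.prod i j l)
  | key_prod (i j : Fin m) (l : Fin d) : ScoreEdge m d (.key j l) (.prod i j l)
  | prod_score (i j : Fin m) (l : Fin d) : ScoreEdge m d (.prod i j l) (.score i j)

/-- The edges of the computation that continues the computation of the scores `Q * Kᵀ` with a
DAG `T`, where `out i j w` says that the score `(i, j)` is an input of the node `w` of `T`. -/
inductive ExtendedEdge (m d : ℕ) {W : Type*} (T : Dag W) (out : Fin m → Fin m → W → Prop) :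
    ScoreNode m d ⊕ W → ScoreNode m d ⊕ W → Prop where
  | scorePart {x y : ScoreNode m d} (h : ScoreEdge m d x y) :
      ExtendedEdge m d T out (Sum.inl x) (Sum.inl y)
  | connect {i j : Fin m} {w : W} (h : out i j w) :
      ExtendedEdge m d T out (Sum.inl (.score i j)) (Sum.inr w)
  | rest {w w' : W} (h : T.Adj w w') : ExtendedEdge m d T out (Sum.inr w) (Sum.inr w')

theorem extendedEdge_acyclic (m d : ℕ) {W : Type*} (T : Dag W) (out : Fin m → Fin m → W → Prop)
    (v : ScoreNode m d ⊕ W) : ¬ Relation.TransGen (ExtendedEdge m d T out) v v := by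
  have hr : ∀ x y, Relation.TransGen (ExtendedEdge m d T out) x y → ∀ w, x = Sum.inr w →
      ∃ w', y = Sum.inr w' ∧ Relation.TransGen T.Adj w w' := by
    intro x y h
    induction h with
    | single h1 =>
      rintro w rfl
      cases h1 with
      | rest h => exact ⟨_, rfl, .single h⟩
    | tail _ h2 ih =>
      intro w hw
      obtain ⟨w', rfl, h3⟩ := ih w hw
      cases h2 with
      | rest h => exact ⟨_, rfl, h3.tail h⟩
  let f : ScoreNode m d ⊕ W → ℕ := fun x => match x with
    | .inl (.query _ _) => 0
    | .inl (.key _ _) => 0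
    | .inl (.prod _ _ _) => 1
    | .inl (.score _ _) => 2
    | .inr _ => 3
  have hf : ∀ x y, Relation.TransGen (ExtendedEdge m d T out) x y →
      f x < f y ∨ (f x = 3 ∧ f y = 3) := by
    have h1 : ∀ x y, ExtendedEdge m d T out x y → f x < f y ∨ (f x = 3 ∧ f y = 3) := by
      intro x y h
      cases h with
      | scorePart h => cases h <;> simp [f]
      | connect h => simp [f]
      | rest h => simp [f]
    intro x y h
    induction h with
    | single h => exact h1 _ _ h
    | tail _ h ih => have := h1 _ _ h; omega
  intro h
  rcases v with x | w
  · have h3 := hf _ _ h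
    cases x <;> simp [f] at h3
  · obtain ⟨w', hw, h4⟩ := hr _ _ h w rfl
    cases hw
    exact T.acyclic _ h4

/-- The DAG that first computes the scores `Q * Kᵀ` by standard matrix multiplication and then
continues with the DAG `T`. -/
def extendedDag (m d : ℕ) {W : Type*} (T : Dag W) (out : Fin m → Fin m → W → Prop) :
    Dag (ScoreNode m d ⊕ W) where
  Adj := ExtendedEdge m d T out
  acyclic := extendedEdge_acyclic m d T out

/-- The nodes that follow the scores in `softmax (Q * Kᵀ) * V`, for an `m × d` matrix `V`: the
exponentials of the scores, their row sums, the normalised weights, the entries of `V`, the products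
of weights and entries of `V`, and the entries of the output. -/
inductive SoftmaxNode (m d : ℕ) where
  | exp (i j : Fin m)
  | rowSum (i : Fin m)
  | weight (i j : Fin m)
  | value (j : Fin m) (l : Fin d)
  | prod (i j : Fin m) (l : Fin d)
  | output (i : Fin m) (l : Fin d)

inductive SoftmaxEdge (m d : ℕ) : SoftmaxNode m d → SoftmaxNode m d → Prop where
  | exp_rowSum (i j : Fin m) : SoftmaxEdge m d (.exp i j) (.rowSum i)
  | exp_weight (i j : Fin m) : SoftmaxEdge m d (.exp i j) (.weight i j)
  | rowSum_weight (i j : Fin m) : SoftmaxEdge m d (.rowSum i) (.weight i j)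
  | weight_prod (i j : Fin m) (l : Fin d) : SoftmaxEdge m d (.weight i j) (.prod i j l)
  | value_prod (i j : Fin m) (l : Fin d) : SoftmaxEdge m d (.value j l) (.prod i j l)
  | prod_output (i j : Fin m) (l : Fin d) : SoftmaxEdge m d (.prod i j l) (.output i l)

def softmaxDag (m d : ℕ) : Dag (SoftmaxNode m d) where
  Adj := SoftmaxEdge m d
  acyclic := Dag.acyclic_of_rank
    (fun x => match x with
      | .exp _ _ => 0
      | .rowSum _ => 1
      | .weight _ _ => 2
      | .value _ _ => 2
      | .prod _ _ _ => 3
      | .output _ _ => 4)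
    (by intro u v h; cases h <;> simp)

/-- The self-attention DAG, which computes `softmax (Q * Kᵀ) * V` with standard matrix
multiplication; each score has exactly one outgoing edge, to its exponential. -/
def selfAttentionDag (m d : ℕ) : Dag (ScoreNode m d ⊕ SoftmaxNode m d) :=
  extendedDag m d (softmaxDag m d) (fun i j w => w = .exp i j)

end Attention

/-!
Cut a strategy into segments that make at most `r` transfers each. The only nodes through which a
segment communicates with the rest of the strategy are those that are red when it starts or ends
and those that it saves or loads; there are at most `3 * r` of them. Any other node on which the
segment operates is computed and used up within it. So if a segment adds the product
`Q i l * K j l` to the score `(i, j)`, then one of three things happens: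

* the product is one of the `3 * r` nodes;
* `Q i l`, `K j l` and `(i, j)` (as a score or through another of its products) are among them;
* the score `(i, j)` is computed from scratch, from a row of `Q` and a row of `K` that are among
  them entirely.

By the Loomis–Whitney inequality there are `O(r * √r)` products of the second kind, and at most
`O(r / d)` rows of either matrix leave `O(r ^ 2 / d)` products of the third kind. As `m ^ 2 * d`
products have to be added, `Ω(m ^ 2 * d / (r * √r + r ^ 2 / d))` segments are needed. A strategy
with fewer than `r` transfers has no full segment; there it is enough that `Q` has to be loaded.
-/

section Counting

open Finset

variable {α β γ : Type*}

theorem loomis_whitney_card {T : Finset (α × β × γ)} {Q : Finset (α × γ)} {K : Finset (β × γ)}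
    {S : Finset (α × β)} (hQ : ∀ i j l, (i, j, l) ∈ T → (i, l) ∈ Q)
    (hK : ∀ i j l, (i, j, l) ∈ T → (j, l) ∈ K) (hS : ∀ i j l, (i, j, l) ∈ T → (i, j) ∈ S) :
    #T ^ 2 ≤ #Q * #K * #S := by
  classical
  let c : Finset γ := T.image (·.2.2)
  let slice (l : γ) : Finset (α × β × γ) := {z ∈ T | z.2.2 = l}
  let sliceQ (l : γ) : Finset (α × γ) := {x ∈ Q | x.2 = l}
  let sliceK (l : γ) : Finset (β × γ) := {y ∈ K | y.2 = l}
  have slice_le_S (l : γ) : #(slice l) ≤ #S :=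
    card_le_card_of_injOn (fun z => (z.1, z.2.1)) (by grind [Set.MapsTo]) (by grind [Set.InjOn])
  have slice_le_mul (l : γ) : #(slice l) ≤ #(sliceQ l) * #(sliceK l) := by
    rw [← card_product]
    exact card_le_card_of_injOn (fun z => ((z.1, z.2.2), (z.2.1, z.2.2)))
      (by grind [Set.MapsTo]) (by grind [Set.InjOn])
  have sum_sliceQ_le : ∑ l ∈ c, #(sliceQ l) ≤ #Q :=
    (sum_card_fiberwise_eq_card_filter Q c (·.2)).trans_le (card_filter_le _ _)
  have sum_sliceK_le : ∑ l ∈ c, #(sliceK l) ≤ #K :=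
    (sum_card_fiberwise_eq_card_filter K c (·.2)).trans_le (card_filter_le _ _)
  calc #T ^ 2 = (∑ l ∈ c, #(slice l)) ^ 2 := by rw [card_eq_sum_card_image (·.2.2) T]
    _ ≤ (∑ l ∈ c, #(sliceQ l)) * ∑ l ∈ c, #(sliceK l) * #S := by
        refine sum_sq_le_sum_mul_sum_of_sq_le_mul c (by simp) (by simp) fun l _ => ?_
        calc #(slice l) ^ 2 = #(slice l) * #(slice l) := sq _
          _ ≤ #(sliceQ l) * #(sliceK l) * #S := Nat.mul_le_mul (slice_le_mul l) (slice_le_S l)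
          _ = #(sliceQ l) * (#(sliceK l) * #S) := mul_assoc _ _ _
    _ ≤ #Q * (#K * #S) := by
        rw [← sum_mul]
        gcongr
    _ = #Q * #K * #S := (mul_assoc _ _ _).symm

open Classical in
/-- The rows all of whose entries belong to the set `Q` of entries of a matrix. -/
noncomputable def fullRows [Fintype α] (Q : Finset (α × γ)) : Finset α := {i | ∀ l, (i, l) ∈ Q}

theorem mem_fullRows [Fintype α] {Q : Finset (α × γ)} {i : α} :
    i ∈ fullRows Q ↔ ∀ l, (i, l) ∈ Q := by
  simp [fullRows]

theorem card_fullRows_mul_le [Fintype α] [Fintype γ] (Q : Finset (α × γ)) :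
    #(fullRows Q) * Fintype.card γ ≤ #Q := by
  rw [← card_univ, ← card_product]
  exact card_le_card fun z hz => mem_fullRows.1 (mem_product.1 hz).1 z.2

theorem card_fullRows_product_le [Fintype α] [Fintype β] [Fintype γ] (Q : Finset (α × γ))
    (K : Finset (β × γ)) :
    (#(fullRows Q ×ˢ fullRows K ×ˢ (univ : Finset γ)) : ℝ) ≤ #Q * #K / Fintype.card γ := by
  rcases isEmpty_or_nonempty γ with hγ | hγ
  · simp
  rw [le_div_iff₀ (by exact_mod_cast Fintype.card_pos), card_product, card_product, card_univ]
  norm_cast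
  calc _ = #(fullRows Q) * Fintype.card γ * (#(fullRows K) * Fintype.card γ) := by ring
    _ ≤ #Q * #K := Nat.mul_le_mul (card_fullRows_mul_le Q) (card_fullRows_mul_le K)

theorem card_le_of_mem_or_fullRows [Finite α] [Finite β] [Fintype γ]
    {T P : Finset (α × β × γ)} {Q : Finset (α × γ)} {K : Finset (β × γ)} {S : Finset (α × β)}
    (hT : ∀ i j l, (i, j, l) ∈ T → (i, j, l) ∈ P ∨
      ((i, l) ∈ Q ∧ (j, l) ∈ K ∧ ((i, j) ∈ S ∨ ∀ l', (i, l') ∈ Q ∧ (j, l') ∈ K))) :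
    (#T : ℝ) ≤ #P + √(#Q * #K * #S) + #Q * #K / Fintype.card γ := by
  classical
  have := Fintype.ofFinite α
  have := Fintype.ofFinite β
  let X : Finset (α × β × γ) := {z ∈ T | z ∉ P ∧ (z.1, z.2.1) ∈ S}
  let B : Finset (α × β × γ) := fullRows Q ×ˢ fullRows K ×ˢ univ
  have hX : (#X : ℝ) ≤ √(#Q * #K * #S) := by
    refine Real.le_sqrt_of_sq_le ?_
    exact_mod_cast loomis_whitney_card (T := X) (by grind) (by grind) (by grind)
  have hB : (#B : ℝ) ≤ #Q * #K / Fintype.card γ := card_fullRows_product_le Q K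
  have hcover : T ⊆ P ∪ X ∪ B := by
    rintro ⟨i, j, l⟩ hz
    have := hT i j l hz
    simp only [mem_union, X, B, mem_fullRows, mem_filter, mem_product, mem_univ, and_true]
    grind
  calc (#T : ℝ) ≤ ((#P + #X + #B : ℕ) : ℝ) := by
        refine Nat.cast_le.2 ((card_le_card hcover).trans ((card_union_le _ _).trans ?_))
        gcongr
        exact card_union_le _ _
    _ = #P + #X + #B := by push_cast; rfl
    _ ≤ _ := by gcongr

end Counting

theorem min_div_mul_add_le {x a b : ℝ} (hx : 0 ≤ x) (ha : 0 ≤ a) (hb : 0 ≤ b) :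
    min (x / a) (x / b) * (a + b) ≤ 2 * x := by
  have div_mul_le (c : ℝ) : x / c * c ≤ x := by
    rcases eq_or_ne c 0 with rfl | hc
    · simpa using hx
    · rw [div_mul_cancel₀ x hc]
  calc min (x / a) (x / b) * (a + b) = min (x / a) (x / b) * a + min (x / a) (x / b) * b := by ring
    _ ≤ x / a * a + x / b * b := by
        gcongr
        · exact min_le_left _ _
        · exact min_le_right _ _
    _ ≤ x + x := add_le_add (div_mul_le a) (div_mul_le b)
    _ = 2 * x := by ring

namespace PRBP

variable {V : Type*} {G : Dag V} {r : ℕ} {s s' : Config V} {a : Move V} {l : List (Move V)}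

section Step

/-- The node whose pebbles are changed by a move. -/
def Move.target : Move V → V
  | .save v => v
  | .load v => v
  | .compute _ v => v
  | .delete v => v

theorem step_pebbles_of_ne {v : V} (hv : v ≠ a.target) :
    (step s a).pebbles v = s.pebbles v := by
  classical
  cases a <;> exact Function.update_of_ne hv _ _

theorem marked_subset_marked_step : s.marked ⊆ (step s a).marked := by
  cases a with
  | compute u v => exact Set.subset_insert _ _
  | _ => exact subset_rfl

theorem mem_marked_of_mem_marked_step {u v : V} (hm : (u, v) ∈ (step s a).marked)
    (hv : v ≠ a.target) : (u, v) ∈ s.marked := by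
  cases a with
  | compute x y => exact hm.resolve_left fun h => hv (Prod.ext_iff.1 h).2
  | _ => exact hm

theorem Pebbles.eq_blue_of_not_hasRed {p : Pebbles} (h : ¬ p.HasRed) (hp : p ≠ .empty) :
    p = .blue := by
  cases p <;> simp_all [Pebbles.HasRed]

theorem Legal.ne_target_of_blue (ha : Legal G s a) {v : V} (hv : s.pebbles v = .blue)
    (hload : a ≠ .load v) : v ≠ a.target := by
  rintro rfl
  cases a <;> simp_all [Legal, Move.target, Pebbles.HasRed]

theorem Legal.mem_marked_of_blue (ha : Legal G s a) {v x y : V} (hv : s.pebbles v = .blue)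
    (hxy : x = v ∨ y = v) (hm : (x, y) ∈ (step s a).marked) : (x, y) ∈ s.marked := by
  cases a with
  | compute u w =>
    obtain ⟨-, -, -, hu, hw⟩ := ha
    refine hm.resolve_left fun h => ?_
    obtain ⟨rfl, rfl⟩ := Prod.ext_iff.1 h
    rcases hxy with rfl | rfl <;> simp_all [Pebbles.HasRed]
  | _ => exact hm

theorem Legal.hasBlue_of_hasBlue_step (ha : Legal G s a) {v : V}
    (hv : ((step s a).pebbles v).HasBlue) (hsave : a ≠ .save v) : (s.pebbles v).HasBlue := by
  by_cases hne : v = a.target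
  · subst hne
    cases a with
    | save u => exact absurd rfl hsave
    | load u => exact ha
    | compute u w => simp [step, Move.target, Pebbles.HasBlue] at hv
    | delete u =>
      by_cases hu : s.pebbles u = .blueLight
      · exact .inr hu
      · simp [step, Move.target, hu, Pebbles.HasBlue] at hv
  · rwa [step_pebbles_of_ne hne] at hv

end Step

section Invariant

/-- Properties shared by all configurations that are reachable from the initial one: an edge is
marked only after all edges into its tail, a node that has been computed on and is still needed
carries a pebble, and sources are never lost. -/
structure Invariant (G : Dag V) (s : Config V) : Prop where
  marked_of_marked : ∀ u v w, (u, v) ∈ s.marked → G.Adj w u → (w, u) ∈ s.marked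
  ne_empty : ∀ u v w, (u, v) ∈ s.marked → G.Adj v w → (v, w) ∉ s.marked → s.pebbles v ≠ .empty
  hasBlue_of_isSource : ∀ v, G.IsSource v → (s.pebbles v).HasBlue

theorem invariant_initial (G : Dag V) : Invariant G (initial G) where
  marked_of_marked _ _ _ h := absurd h (Set.notMem_empty _)
  ne_empty _ _ _ h := absurd h (Set.notMem_empty _)
  hasBlue_of_isSource v hv := by simp [initial, hv, Pebbles.HasBlue]

theorem Invariant.step (hs : Invariant G s) (ha : Legal G s a) : Invariant G (step s a) where
  marked_of_marked u v w huv hwu := by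
    cases a with
    | compute x y =>
      rcases huv with h | huv
      · obtain ⟨rfl, rfl⟩ := Prod.ext_iff.1 h
        exact .inr (ha.2.2.1 w hwu)
      · exact .inr (hs.marked_of_marked u v w huv hwu)
    | _ => exact hs.marked_of_marked u v w huv hwu
  ne_empty u v w huv hvw hm := by
    by_cases hv : v = a.target
    · subst hv
      cases a with
      | delete x =>
        have hx : s.pebbles x = .blueLight := ha.resolve_right fun h => hm (h.2 w hvw)
        simp [PRBP.step, Move.target, hx]
      | _ => simp [PRBP.step, Move.target]
    · rw [step_pebbles_of_ne hv]
      exact hs.ne_empty u v w (mem_marked_of_mem_marked_step huv hv) hvw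
        fun h => hm (marked_subset_marked_step h)
  hasBlue_of_isSource v hv := by
    have hblue := hs.hasBlue_of_isSource v hv
    by_cases hne : v = a.target
    · subst hne
      cases a with
      | compute x y => exact absurd ha.1 (hv x)
      | delete x =>
        have hx : s.pebbles x = .blueLight :=
          ha.resolve_right fun h => by simp [Move.target, h.1, Pebbles.HasBlue] at hblue
        simp [PRBP.step, Move.target, hx, Pebbles.HasBlue]
      | _ => simp [PRBP.step, Move.target, Pebbles.HasBlue]
    · rwa [step_pebbles_of_ne hne]

end Invariant

section Play

/-- The moves `l` lead from `s` to `s'`, are legal, and never use more than `r` red pebbles. This is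
a segment of a strategy: in contrast to `Completes`, `s'` need not be terminal. -/
inductive Play (G : Dag V) (r : ℕ) : Config V → List (Move V) → Config V → Prop where
  | nil {s : Config V} (h : FitsIn s r) : Play G r s [] s
  | cons {s s' : Config V} {a : Move V} {l : List (Move V)} (h : FitsIn s r) (ha : Legal G s a)
      (hl : Play G r (step s a) l s') : Play G r s (a :: l) s'

theorem Completes.exists_play_of_append {l₁ l₂ : List (Move V)}
    (h : Completes G r s (l₁ ++ l₂)) : ∃ s', Play G r s l₁ s' ∧ Completes G r s' l₂ := by
  induction l₁ generalizing s with
  | nil =>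
    have hfits : FitsIn s r := by cases l₂ <;> exact h.1
    exact ⟨s, .nil hfits, h⟩
  | cons a l ih =>
    obtain ⟨hfits, ha, hl⟩ := h
    obtain ⟨s', hplay, hrest⟩ := ih hl
    exact ⟨s', .cons hfits ha hplay, hrest⟩

theorem Completes.exists_play (h : Completes G r s l) : ∃ s', Play G r s l s' ∧ Terminal G s' := by
  obtain ⟨s', hplay, hend⟩ := Completes.exists_play_of_append (l₂ := []) (by simpa using h)
  exact ⟨s', hplay, hend.2⟩

namespace Play

theorem fitsIn_left (h : Play G r s l s') : FitsIn s r := by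
  cases h <;> assumption

theorem fitsIn_right (h : Play G r s l s') : FitsIn s' r := by
  induction h with
  | nil h => exact h
  | cons _ _ _ ih => exact ih

theorem invariant (h : Play G r s l s') (hs : Invariant G s) : Invariant G s' := by
  induction h with
  | nil => exact hs
  | cons _ ha _ ih => exact ih (hs.step ha)

theorem mem_marked_of_blue (h : Play G r s l s') {v x y : V} (hv : s.pebbles v = .blue)
    (hload : .load v ∉ l) (hxy : x = v ∨ y = v) (hm : (x, y) ∈ s'.marked) : (x, y) ∈ s.marked := by
  induction h with
  | nil => exact hm
  | cons _ ha _ ih =>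
    obtain ⟨hne, hload⟩ := List.ne_and_not_mem_of_not_mem_cons hload
    have hv' := (step_pebbles_of_ne (ha.ne_target_of_blue hv (Ne.symm hne))).trans hv
    exact ha.mem_marked_of_blue hv hxy (ih hv' hload hm)

theorem hasBlue_of_hasBlue (h : Play G r s l s') {v : V} (hv : (s'.pebbles v).HasBlue)
    (hsave : .save v ∉ l) : (s.pebbles v).HasBlue := by
  induction h with
  | nil => exact hv
  | cons _ ha _ ih =>
    obtain ⟨hne, hsave⟩ := List.ne_and_not_mem_of_not_mem_cons hsave
    exact ha.hasBlue_of_hasBlue_step (ih hv hsave) (Ne.symm hne)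

end Play

end Play

section Cost

theorem cost_cons (a : Move V) (l : List (Move V)) : cost (a :: l) = a.cost + cost l := rfl

/-- The nodes whose values are moved between the two memories by `l`. -/
def transferred (l : List (Move V)) : Set V := {v | .save v ∈ l ∨ .load v ∈ l}

theorem encard_transferred_le (l : List (Move V)) : (transferred l).encard ≤ cost l := by
  induction l with
  | nil => simp [transferred]
  | cons a l ih =>
    have insert_le (v : V) : (insert v (transferred l)).encard ≤ ((1 + cost l : ℕ) : ℕ∞) := by
      rw [add_comm, Nat.cast_add_one]
      exact (Set.encard_insert_le _ _).trans (by gcongr)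
    cases a with
    | save v | load v =>
      refine (Set.encard_le_encard fun u hu => ?_).trans (insert_le v)
      simp only [transferred, List.mem_cons, Set.mem_ofPred_eq, Set.mem_insert_iff] at hu ⊢
      grind
    | compute u v | delete v => simpa [transferred, cost_cons, Move.cost] using ih

theorem exists_append_cost_eq {k : ℕ} (hk : k ≤ cost l) :
    ∃ l₁ l₂, l = l₁ ++ l₂ ∧ cost l₁ = k ∧ cost l = k + cost l₂ := by
  induction l generalizing k with
  | nil => exact ⟨[], [], rfl, (Nat.le_zero.1 hk).symm, by simp_all [cost]⟩
  | cons a l ih =>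
    have ha : a.cost ≤ 1 := by cases a <;> simp [Move.cost]
    rcases Nat.eq_zero_or_pos k with rfl | hpos
    · exact ⟨[], a :: l, rfl, rfl, (Nat.zero_add _).symm⟩
    · rw [cost_cons] at hk
      obtain ⟨l₁, l₂, rfl, h₁, h₂⟩ := ih (k := k - a.cost) (by omega)
      exact ⟨a :: l₁, l₂, rfl, by rw [cost_cons]; omega, by rw [cost_cons]; omega⟩

theorem encard_sources_le_cost (hl : IsStrategy G r l) :
    {v | G.IsSource v ∧ ¬ G.IsSink v}.encard ≤ cost l := by
  obtain ⟨s', hplay, -, hmarked⟩ := Completes.exists_play hl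
  refine (Set.encard_le_encard fun v hv => ?_).trans (encard_transferred_le l)
  obtain ⟨hsource, hsink⟩ := hv
  obtain ⟨w, hvw⟩ : ∃ w, G.Adj v w := by simpa [Dag.IsSink] using hsink
  by_contra hnot
  exact hplay.mem_marked_of_blue (by simp [initial, hsource]) (fun h => hnot (.inr h)) (.inl rfl)
    (hmarked v w hvw)

theorem ofReal_le_opt {x : ℝ} (h : ∀ l, IsStrategy G r l → x ≤ cost l) :
    ENNReal.ofReal x ≤ (opt G r : ENNReal) := by
  simp only [opt, ENat.toENNReal_iInf, ENat.toENNReal_coe]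
  exact le_iInf₂ fun l hl => ENNReal.ofReal_le_natCast.2 (h l hl)

end Cost

section Boundary

/-- The nodes through which the moves `l` from `s` to `s'` communicate with what happens before and
after: those in fast memory at either end, and those transferred by `l`. -/
def boundary (s : Config V) (l : List (Move V)) (s' : Config V) : Set V :=
  {v | (s.pebbles v).HasRed} ∪ {v | (s'.pebbles v).HasRed} ∪ transferred l

namespace Play

theorem encard_boundary_le (h : Play G r s l s') :
    (boundary s l s').encard ≤ ((2 * r + cost l : ℕ) : ℕ∞) := by
  calc (boundary s l s').encard
      ≤ {v | (s.pebbles v).HasRed}.encard + {v | (s'.pebbles v).HasRed}.encard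
          + (transferred l).encard :=
        (Set.encard_union_le _ _).trans (add_le_add_left (Set.encard_union_le _ _) _)
    _ ≤ (r : ℕ∞) + r + cost l :=
        add_le_add (add_le_add h.fitsIn_left h.fitsIn_right) (encard_transferred_le l)
    _ = ((2 * r + cost l : ℕ) : ℕ∞) := by push_cast; ring

theorem eq_empty_of_notMem_boundary (h : Play G r s l s') {v x y : V}
    (hv : v ∉ boundary s l s') (hxy : x = v ∨ y = v) (hm : (x, y) ∈ s'.marked \ s.marked) :
    s.pebbles v = .empty := by
  by_contra hne
  simp only [boundary, transferred, Set.mem_union, Set.mem_ofPred_eq, not_or] at hv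
  exact hm.2 (h.mem_marked_of_blue (Pebbles.eq_blue_of_not_hasRed hv.1.1 hne) hv.2.2 hxy hm.1)

theorem mem_boundary_of_isSource (h : Play G r s l s') (hs : Invariant G s) {v w : V}
    (hv : G.IsSource v) (hm : (v, w) ∈ s'.marked \ s.marked) : v ∈ boundary s l s' := by
  by_contra hnot
  have hempty := h.eq_empty_of_notMem_boundary hnot (.inl rfl) hm
  have hblue := hs.hasBlue_of_isSource v hv
  simp [hempty, Pebbles.HasBlue] at hblue

theorem in_edge_mem_of_out_edge_mem (h : Play G r s l s') (hs : Invariant G s) {u v w : V}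
    (hv : v ∉ boundary s l s') (huv : G.Adj u v) (hvw : G.Adj v w)
    (hm : (v, w) ∈ s'.marked \ s.marked) : (u, v) ∈ s'.marked \ s.marked :=
  ⟨(h.invariant hs).marked_of_marked v w u hm.1 huv, fun hu =>
    hs.ne_empty u v w hu hvw hm.2 (h.eq_empty_of_notMem_boundary hv (.inl rfl) hm)⟩

theorem in_edge_mem_of_in_edge_mem (h : Play G r s l s') (hs : Invariant G s) {u u' v w : V}
    (hv : v ∉ boundary s l s') (huv : G.Adj u v) (hu'v : G.Adj u' v) (hvw : G.Adj v w)
    (hm : (u, v) ∈ s'.marked \ s.marked) : (u', v) ∈ s'.marked \ s.marked := by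
  have hempty := h.eq_empty_of_notMem_boundary hv (.inr rfl) hm
  refine ⟨?_, fun hu' => hs.ne_empty u' v w hu' hvw
    (fun hvw' => hm.2 (hs.marked_of_marked v w u hvw' huv)) hempty⟩
  by_contra hu'
  have hs' := h.invariant hs
  have hne := hs'.ne_empty u v w hm.1 hvw fun hvw' => hu' (hs'.marked_of_marked v w u' hvw' hu'v)
  simp only [boundary, transferred, Set.mem_union, Set.mem_ofPred_eq, not_or] at hv
  have hblue := Pebbles.eq_blue_of_not_hasRed hv.1.2 hne
  have := h.hasBlue_of_hasBlue (.inl hblue) hv.2.1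
  simp [hempty, Pebbles.HasBlue] at this

end Play

end Boundary

section Segments

open Finset

open Classical in
theorem card_unmarked_le_of_segments {ι : Type*} [Fintype ι] {e : ι → V × V}
    (he : ∀ i, G.Adj (e i).1 (e i).2) {k : ℕ} (hk : 0 < k) {B : ℝ}
    (hB : ∀ s l s', Invariant G s → Play G r s l s' → cost l ≤ k →
      (#{i | e i ∈ s'.marked \ s.marked} : ℝ) ≤ B)
    (hs : Invariant G s) (hl : Completes G r s l) :
    (#{i | e i ∉ s.marked} : ℝ) ≤ ((cost l / k + 1 : ℕ) : ℝ) * B := by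
  induction hn : cost l using Nat.strong_induction_on generalizing s l with
  | _ n ih =>
    subst hn
    rcases le_or_gt (cost l) k with hle | hlt
    · obtain ⟨s', hplay, -, hmarked⟩ := hl.exists_play
      have hcount := hB s l s' hs hplay hle
      simp only [Set.mem_sdiff, fun i => hmarked _ _ (he i), true_and] at hcount
      refine hcount.trans (le_mul_of_one_le_left ((Nat.cast_nonneg _).trans hcount) ?_)
      exact_mod_cast Nat.le_add_left 1 _
    · obtain ⟨l₁, l₂, rfl, h₁, h₂⟩ := exists_append_cost_eq hlt.le
      obtain ⟨s', hplay, hrest⟩ := hl.exists_play_of_append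
      have hsplit : #{i | e i ∉ s.marked} ≤
          #{i | e i ∈ s'.marked \ s.marked} + #{i | e i ∉ s'.marked} := by
        refine (card_le_card fun i hi => ?_).trans (card_union_le _ _)
        by_cases hi' : e i ∈ s'.marked <;> simp_all
      calc (#{i | e i ∉ s.marked} : ℝ)
          ≤ #{i | e i ∈ s'.marked \ s.marked} + #{i | e i ∉ s'.marked} := by
            exact_mod_cast hsplit
        _ ≤ B + ((cost l₂ / k + 1 : ℕ) : ℝ) * B :=
            add_le_add (hB _ _ _ hs hplay h₁.le)
              (ih (cost l₂) (by omega) (hplay.invariant hs) hrest rfl)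
        _ = _ := by
            rw [h₂, Nat.add_div_left _ hk]
            push_cast
            ring

end Segments

end PRBP

namespace Attention

open Finset PRBP

variable {m d : ℕ}

section Products

/-- A bound on the number of products that are added to their scores by a sequence of moves with a
boundary of `n` nodes. -/
noncomputable def productBound (d n : ℕ) : ℝ := n + n * √n + n ^ 2 / d

theorem card_entries_le (A : Finset (ScoreNode m d))
    [DecidablePred fun z : Fin m × Fin m => .score z.1 z.2 ∈ A ∨ ∃ l, .prod z.1 z.2 l ∈ A] :
    #{z : Fin m × Fin m | .score z.1 z.2 ∈ A ∨ ∃ l, .prod z.1 z.2 l ∈ A} ≤ #A := by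
  refine card_le_card_of_forall_subsingleton
    (fun z x => x = .score z.1 z.2 ∨ ∃ l, x = .prod z.1 z.2 l) (fun z hz => ?_) ?_
  · rcases (mem_filter.1 hz).2 with h | ⟨l, h⟩
    · exact ⟨_, h, .inl rfl⟩
    · exact ⟨_, h, .inr ⟨l, rfl⟩⟩
  · rintro x - ⟨i, j⟩ ⟨-, rfl | ⟨l, rfl⟩⟩ ⟨i', j'⟩ ⟨-, h | ⟨l', h⟩⟩ <;> simp_all

theorem card_products_le {A : Finset (ScoreNode m d)} {n : ℕ} (hA : #A ≤ n)
    {T : Finset (Fin m × Fin m × Fin d)}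
    (hT : ∀ i j l, (i, j, l) ∈ T → .prod i j l ∈ A ∨
      (.query i l ∈ A ∧ .key j l ∈ A ∧ (.score i j ∈ A ∨ ∀ l', (i, j, l') ∈ T))) :
    (#T : ℝ) ≤ productBound d n := by
  classical
  let P : Finset (Fin m × Fin m × Fin d) := {z | .prod z.1 z.2.1 z.2.2 ∈ A}
  let Q : Finset (Fin m × Fin d) := {z | .query z.1 z.2 ∈ A}
  let K : Finset (Fin m × Fin d) := {z | .key z.1 z.2 ∈ A}
  let S : Finset (Fin m × Fin m) := {z | .score z.1 z.2 ∈ A ∨ ∃ l, .prod z.1 z.2 l ∈ A}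
  have hP : #P ≤ n := (card_le_card_of_injOn (fun z => .prod z.1 z.2.1 z.2.2)
    (by simp [Set.MapsTo, P]) (by grind [Set.InjOn])).trans hA
  have hQ : #Q ≤ n := (card_le_card_of_injOn (fun z => .query z.1 z.2)
    (by simp [Set.MapsTo, Q]) (by grind [Set.InjOn])).trans hA
  have hK : #K ≤ n := (card_le_card_of_injOn (fun z => .key z.1 z.2)
    (by simp [Set.MapsTo, K]) (by grind [Set.InjOn])).trans hA
  have hS : #S ≤ n := (card_entries_le A).trans hA
  have hcover : ∀ i j l, (i, j, l) ∈ T → (i, j, l) ∈ P ∨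
      ((i, l) ∈ Q ∧ (j, l) ∈ K ∧ ((i, j) ∈ S ∨ ∀ l', (i, l') ∈ Q ∧ (j, l') ∈ K)) := by
    simp only [P, Q, K, S, mem_filter, mem_univ, true_and]
    intro i j l h
    rcases hT i j l h with hprod | ⟨hquery, hkey, hscore | hall⟩
    · exact .inl hprod
    · exact .inr ⟨hquery, hkey, .inl (.inl hscore)⟩
    · refine .inr ⟨hquery, hkey, or_iff_not_imp_left.2 fun hnot l' => ?_⟩
      obtain ⟨hquery', hkey', -⟩ :=
        (hT i j l' (hall l')).resolve_left fun hprod => hnot (.inr ⟨l', hprod⟩)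
      exact ⟨hquery', hkey'⟩
  calc (#T : ℝ) ≤ #P + √(#Q * #K * #S) + #Q * #K / Fintype.card (Fin d) :=
        card_le_of_mem_or_fullRows hcover
    _ ≤ n + √(n * n * n) + n * n / d := by
        rw [Fintype.card_fin]
        gcongr
    _ = productBound d n := by
        rw [Real.sqrt_mul (by positivity), Real.sqrt_mul_self (by positivity), productBound, sq]

theorem productBound_three_mul_le (d : ℕ) {r : ℕ} (hr : 0 < r) :
    productBound d (3 * r) ≤ 9 * r * (√r + r / d) := by
  have one_le_sqrt : 1 ≤ √(r : ℝ) := Real.one_le_sqrt.2 (by exact_mod_cast hr)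
  have sqrt_le : √(3 * r : ℝ) ≤ 2 * √r := by
    rw [Real.sqrt_le_left (by positivity), mul_pow, Real.sq_sqrt (by positivity)]
    linarith
  calc productBound d (3 * r) = 3 * r * 1 + 3 * r * √(3 * r) + (3 * r) ^ 2 / d := by
        simp [productBound]
    _ ≤ 3 * r * √r + 3 * r * (2 * √r) + (3 * r) ^ 2 / d := by gcongr
    _ = 9 * r * (√r + r / d) := by ring

end Products

section LowerBound

variable {r : ℕ} {W : Type*} {T : Dag W} {out : Fin m → Fin m → W → Prop}

/-- The edge along which the product `Q i l * K j l` is added to the score `(i, j)`, where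
`z = (i, j, l)`. -/
def addEdge (W : Type*) (z : Fin m × Fin m × Fin d) :
    (ScoreNode m d ⊕ W) × (ScoreNode m d ⊕ W) :=
  (.inl (.prod z.1 z.2.1 z.2.2), .inl (.score z.1 z.2.1))

theorem isSource_query (i : Fin m) (l : Fin d) :
    (extendedDag m d T out).IsSource (.inl (.query i l)) := by
  rintro _ ⟨⟨⟩⟩

theorem isSource_key (j : Fin m) (l : Fin d) :
    (extendedDag m d T out).IsSource (.inl (.key j l)) := by
  rintro _ ⟨⟨⟩⟩

theorem adj_query_prod (i j : Fin m) (l : Fin d) :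
    (extendedDag m d T out).Adj (.inl (.query i l)) (.inl (.prod i j l)) :=
  .scorePart (.query_prod i j l)

theorem adj_key_prod (i j : Fin m) (l : Fin d) :
    (extendedDag m d T out).Adj (.inl (.key j l)) (.inl (.prod i j l)) :=
  .scorePart (.key_prod i j l)

theorem adj_prod_score (i j : Fin m) (l : Fin d) :
    (extendedDag m d T out).Adj (.inl (.prod i j l)) (.inl (.score i j)) :=
  .scorePart (.prod_score i j l)

theorem mul_le_cost {l : List (Move (ScoreNode m d ⊕ W))}
    (hl : IsStrategy (extendedDag m d T out) r l) : m * d ≤ cost l := by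
  let query (z : Fin m × Fin d) : ScoreNode m d ⊕ W := .inl (.query z.1 z.2)
  have query_injective : query.Injective := by
    rintro ⟨i, k⟩ ⟨i', k'⟩ h
    simpa [query] using h
  have range_subset : Set.range query ⊆
      {v | (extendedDag m d T out).IsSource v ∧ ¬ (extendedDag m d T out).IsSink v} :=
    Set.range_subset_iff.2 fun z =>
      ⟨isSource_query _ _, fun hsink => hsink _ (adj_query_prod z.1 z.1 z.2)⟩
  have := (Set.encard_le_encard range_subset).trans (encard_sources_le_cost hl)
  rw [← Set.image_univ, query_injective.encard_image, Set.encard_univ,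
    ENat.card_eq_coe_fintype_card, Nat.cast_le] at this
  simpa using this

section Segment

variable {s s' : Config (ScoreNode m d ⊕ W)} {l : List (Move (ScoreNode m d ⊕ W))}

theorem mem_boundary_of_added (hout : ∀ i j, ∃ w, out i j w)
    (h : Play (extendedDag m d T out) r s l s') (hs : Invariant (extendedDag m d T out) s)
    {i j : Fin m} {k : Fin d} (hm : addEdge W (i, j, k) ∈ s'.marked \ s.marked) :
    .inl (.prod i j k) ∈ boundary s l s' ∨
      (.inl (.query i k) ∈ boundary s l s' ∧ .inl (.key j k) ∈ boundary s l s' ∧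
        (.inl (.score i j) ∈ boundary s l s' ∨
          ∀ k', addEdge W (i, j, k') ∈ s'.marked \ s.marked)) := by
  by_cases hprod : .inl (.prod i j k) ∈ boundary s l s'
  · exact .inl hprod
  have hadj := adj_prod_score (d := d) (T := T) (out := out) i j
  have hin {u} (hu : (extendedDag m d T out).Adj u (.inl (.prod i j k))) :=
    h.in_edge_mem_of_out_edge_mem hs hprod hu (hadj k) hm
  refine .inr ⟨h.mem_boundary_of_isSource hs (isSource_query i k) (hin (adj_query_prod i j k)),
    h.mem_boundary_of_isSource hs (isSource_key j k) (hin (adj_key_prod i j k)), ?_⟩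
  by_cases hscore : .inl (.score i j) ∈ boundary s l s'
  · exact .inl hscore
  · obtain ⟨w, hw⟩ := hout i j
    exact .inr fun k' =>
      h.in_edge_mem_of_in_edge_mem hs hscore (hadj k) (hadj k') (.connect hw) hm

open Classical in
theorem card_added_le (hout : ∀ i j, ∃ w, out i j w)
    (h : Play (extendedDag m d T out) r s l s') (hs : Invariant (extendedDag m d T out) s)
    {n : ℕ} (hn : (boundary s l s').encard ≤ n) :
    (#{z | addEdge W z ∈ s'.marked \ s.marked} : ℝ) ≤ productBound d n := by
  have hle : (Sum.inl ⁻¹' boundary s l s' : Set (ScoreNode m d)).encard ≤ n := by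
    rw [← Sum.inl_injective.encard_image]
    exact (Set.encard_le_encard (Set.image_preimage_subset _ _)).trans hn
  have hfin := Set.finite_of_encard_le_coe hle
  refine card_products_le (A := hfin.toFinset) ?_ fun i j k hz => ?_
  · rwa [hfin.encard_eq_coe_toFinset_card, Nat.cast_le] at hle
  · simp only [Set.Finite.mem_toFinset, Set.mem_preimage, mem_filter, mem_univ, true_and] at hz ⊢
    exact mem_boundary_of_added hout h hs hz

end Segment

theorem sq_mul_le_mul_productBound (hr : 0 < r) (hout : ∀ i j, ∃ w, out i j w)
    {l : List (Move (ScoreNode m d ⊕ W))} (hl : IsStrategy (extendedDag m d T out) r l) :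
    (m : ℝ) ^ 2 * d ≤ ((cost l / r + 1 : ℕ) : ℝ) * productBound d (3 * r) := by
  classical
  have hcount := card_unmarked_le_of_segments (e := addEdge W)
    (fun z => adj_prod_score (T := T) (out := out) z.1 z.2.1 z.2.2) hr
    (fun s l s' hs hplay hcost => card_added_le hout hplay hs (n := 3 * r)
      (hplay.encard_boundary_le.trans (by norm_cast; omega)))
    (invariant_initial _) hl
  calc (m : ℝ) ^ 2 * d
      = #{z : Fin m × Fin m × Fin d | addEdge W z ∉ (initial (extendedDag m d T out)).marked} := by
        simp [initial]
        ring
    _ ≤ _ := hcount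

theorem le_cost (hr : 0 < r) (hout : ∀ i j, ∃ w, out i j w)
    {l : List (Move (ScoreNode m d ⊕ W))} (hl : IsStrategy (extendedDag m d T out) r l) :
    1 / 36 * min ((m : ℝ) ^ 2 * d / √(r : ℝ)) ((m : ℝ) ^ 2 * (d : ℝ) ^ 2 / r) ≤ cost l := by
  have hr0 : (0 : ℝ) < r := by exact_mod_cast hr
  set M : ℝ := min ((m : ℝ) ^ 2 * d / √(r : ℝ)) ((m : ℝ) ^ 2 * (d : ℝ) ^ 2 / r)
  suffices M ≤ 36 * cost l by linarith
  rcases lt_or_ge (cost l) r with hlt | hge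
  · have hmd : (m * d : ℝ) ≤ cost l := by exact_mod_cast mul_le_cost hl
    have hcr : (cost l : ℝ) ≤ r := by exact_mod_cast hlt.le
    calc M ≤ (m : ℝ) ^ 2 * (d : ℝ) ^ 2 / r := min_le_right _ _
      _ = (m * d) * (m * d) / r := by ring
      _ ≤ cost l * r / r := by gcongr; exact hmd.trans hcr
      _ = cost l := mul_div_cancel_right₀ _ hr0.ne'
      _ ≤ 36 * cost l := by linarith [(cost l).cast_nonneg (α := ℝ)]
  · have hsegments : ((cost l / r + 1 : ℕ) : ℝ) ≤ 2 * (cost l / r) := by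
      have hone : (1 : ℝ) ≤ cost l / r := (one_le_div hr0).2 (by exact_mod_cast hge)
      push_cast
      linarith [Nat.cast_div_le (m := cost l) (n := r) (α := ℝ)]
    have hM : M = min ((m : ℝ) ^ 2 * d / √r) ((m : ℝ) ^ 2 * d / (r / d)) := by
      rw [div_div_eq_mul_div, mul_assoc, ← sq]
    refine le_of_mul_le_mul_right ?_ (by positivity : (0 : ℝ) < √r + r / d)
    calc M * (√r + r / d) ≤ 2 * ((m : ℝ) ^ 2 * d) := by
          rw [hM]
          exact min_div_mul_add_le (by positivity) (by positivity) (by positivity)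
      _ ≤ 2 * (2 * (cost l / r) * (9 * r * (√r + r / d))) := by
          refine mul_le_mul_of_nonneg_left ?_ zero_le_two
          refine (sq_mul_le_mul_productBound hr hout hl).trans ?_
          exact mul_le_mul hsegments (productBound_three_mul_le d hr)
            (by unfold productBound; positivity) (by positivity)
      _ = 36 * cost l * (√r + r / d) := by
          field_simp
          ring

end LowerBound

end Attention

theorem mainTheorem6_general {m d r : ℕ} (hr : 0 < r) {W : Type*} {T : Dag W}
    {out : Fin m → Fin m → W → Prop} (hout : ∀ i j, ∃ w, out i j w) :
    ENNReal.ofReal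
        (1 / 36 * min ((m : ℝ) ^ 2 * d / √(r : ℝ)) ((m : ℝ) ^ 2 * (d : ℝ) ^ 2 / r))
      ≤ (PRBP.opt (Attention.extendedDag m d T out) r : ENNReal) :=
  PRBP.ofReal_le_opt fun _ hl => Attention.le_cost hr hout hl

theorem mainTheorem6 :
    ∃ c : ℝ, 0 < c ∧ ∀ m d r : ℕ, 0 < m → 0 < d → 0 < r →
      ENNReal.ofReal (c * min ((m : ℝ) ^ 2 * d / √(r : ℝ)) ((m : ℝ) ^ 2 * (d : ℝ) ^ 2 / r))
          ≤ (PRBP.opt (Attention.selfAttentionDag m d) r : ENNReal) ∧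
      ∀ (W : Type) [Finite W] (T : Dag W) (out : Fin m → Fin m → W → Prop),
        (∀ i j, ∃ w, out i j w) →
        ENNReal.ofReal (c * min ((m : ℝ) ^ 2 * d / √(r : ℝ)) ((m : ℝ) ^ 2 * (d : ℝ) ^ 2 / r))
          ≤ (PRBP.opt (Attention.extendedDag m d T out) r : ENNReal) := by
  refine ⟨1 / 36, by norm_num, fun m d r _ _ hr => ⟨?_, fun W _ T out hout => ?_⟩⟩
  · exact mainTheorem6_general hr fun i j => ⟨_, rfl⟩
  · exact mainTheorem6_general hr hout
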